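/- Let $(X,d)$ be a metric space and let $\mathfrak B$ be a bornology on $X$, i.e. a family of subsets of $X$ that covers $X$ and is closed under subsets and finite unions. Assume that $X\notin\mathfrak B$ and that $\mathfrak B$ has a compact base, i.e. every member of $\mathfrak B$ is contained in a compact member of $\mathfrak B$. *Notation.* For $B\subseteq X$ and $\delta>0$ let $B^\delta=\{y\in X: d(x,y)<\delta\text{ for some }x\in B\}$. An open $\mathfrak B^s$-cover of $X$ is a family $\mathcal U$ of open subsets of $X$ with $X\notin\mathcal U$ such that for every $B\in\mathfrak B$ there are $U\in\mathcal U$ and $\delta>0$ with $B^\delta\subseteq U$. $X$ has the $\mathfrak B^s$-Hurewicz property if for every sequence $(\mathcal U_k)_{k\in\mathbb N}$ of open $\mathfrak B^s$-covers of $X$ there are finite sets $\mathcal V_k\subseteq\mathcal U_k$ $(k\in\mathbb N)$ such that for every $B\in\mathfrak B$ there are $k_0\in\mathbb N$ and $\delta_k>0$ $(k\ge k_0)$ such that for every $k\ge k_0$ one has $B^{\delta_k}\subseteq U$ for some $U\in\mathcal V_k$. For $n\ge1$, $X^n$ carries the maximum metric and $\mathfrak B^n$ is the bornology on $X^n$ with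 base $\{B^n:B\in\mathfrak B\}$; open $(\mathfrak B^n)^s$-covers and the $(\mathfrak B^n)^s$-Hurewicz property of $X^n$ are defined in the same way. Let $C(X)$ be the set of continuous functions $X\to\mathbb R$, $\underline 0$ the zero function, and $\tau^s_{\mathfrak B}$ the topology on $C(X)$ given by the uniformity with base $$[B,\varepsilon]^s=\{(f,g): \text{there is } \delta>0 \text{ with } |f(x)-g(x)|<\varepsilon \text{ for all } x\in B^\delta\},\qquad B\in\mathfrak B,\ \varepsilon>0 .$$ For a point $y$ of a topological space $Y$ let $\Omega_y=\{A\subseteq Y: y\in\overline A\setminus A\}$, and let $\Omega_y^{gp}$ be the set of all countable $A\in\Omega_y$ that are the union of a sequence $(A_n)_{n\in\mathbb N}$ of pairwise disjoint finite sets such that every neighbourhood of $y$ meets $A_n$ for all but finitely many $n$. The principle $\mathsf S_{fin}(\mathcal A,\mathcal C)$ says that for every sequence $(A_n)_{n\in\mathbb N}$ in $\mathcal A$ there are finite (possibly empty) sets $F_n\subseteq A_n$ with $\bigcup_nF_n\in\mathcal C$. In the game $\mathsf G_{fin}(\mathcal A,\mathcal C)$, in round $n\in\mathbb N$ player ONE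 chooses $A_n\in\mathcal A$ and then player TWO chooses a finite (possibly empty) set $F_n\subseteq A_n$; TWO wins the play if $\bigcup_nF_n\in\mathcal C$, otherwise ONE wins. $Y$ has countable fan tightness if $\mathsf S_{fin}(\Omega_y,\Omega_y)$ holds for every $y\in Y$, and it has Reznichenko's property if for every $y\in Y$ every countable member of $\Omega_y$ belongs to $\Omega_y^{gp}$. **Corollary.** The following statements are equivalent. 1. $X^n$ has the $(\mathfrak B^n)^s$-Hurewicz property for every integer $n\ge 1$. 2. $(C(X),\tau^s_{\mathfrak B})$ has countable fan tightness and Reznichenko's property. 3. $(C(X),\tau^s_{\mathfrak B})$ satisfies $\mathsf S_{fin}(\Omega_{\underline 0},\Omega_{\underline 0}^{gp})$. 4. ONE does not have a winning strategy in the game $\mathsf G_{fin}(\Omega_{\underline 0},\Omega_{\underline 0}^{gp})$ on $(C(X),\tau^s_{\mathfrak B})$. -/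

import Mathlib

open Set Filter Topology

namespace BornSel

universe u

/-! ### Selection principles and games -/

section Selection

variable {S : Type u}

/-- The selection principle `S_fin(𝒜, ℬ)`. -/
def SFin (𝒜 ℬ : Set (Set S)) : Prop :=
  ∀ A : ℕ → Set S, (∀ n, A n ∈ 𝒜) →
    ∃ F : ℕ → Set S, (∀ n, (F n).Finite ∧ F n ⊆ A n) ∧ (⋃ n, F n) ∈ ℬ

/-- ONE has a winning strategy in the game `G_fin(𝒜, ℬ)`. In round `n` ONE chooses `A n ∈ 𝒜` and TWO
answers with a finite (possibly empty) `F n ⊆ A n`; TWO wins if `⋃ n, F n ∈ ℬ`, otherwise ONE wins.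
A strategy of ONE sends the finite list of the previous moves of TWO to an element of `𝒜`
(the values at lists that do not arise in a play do not matter); it is winning if
ONE wins every play in which ONE follows it. -/
def OneHasWinningStrategyGFin (𝒜 ℬ : Set (Set S)) : Prop :=
  ∃ σ : List (Set S) → Set S, (∀ l, σ l ∈ 𝒜) ∧
    ∀ F : ℕ → Set S, (∀ n, (F n).Finite ∧ F n ⊆ σ ((List.range n).map F)) → (⋃ n, F n) ∉ ℬ

end Selection

/-! ### Local properties of a topological space -/

section Tightness

variable {Y : Type u} [TopologicalSpace Y]

/-- `Ω_y`: the sets `A` with `y ∈ closure A \ A`. -/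
def Omega (y : Y) : Set (Set Y) := {A | y ∈ closure A \ A}

/-- `Ω_y^gp`: the countable `A ∈ Ω_y` that have a partition into pairwise disjoint finite sets `P n`
such that every neighbourhood of `y` meets `P n` for all but finitely many `n`. -/
def OmegaGp (y : Y) : Set (Set Y) :=
  {A | A ∈ Omega y ∧ A.Countable ∧
    ∃ P : ℕ → Set Y, (∀ n, (P n).Finite) ∧ (∀ m n, m ≠ n → Disjoint (P m) (P n)) ∧
      (⋃ n, P n) = A ∧ ∀ W ∈ 𝓝 y, ∀ᶠ n in atTop, (W ∩ P n).Nonempty}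

variable (Y)

/-- Countable fan tightness (at every point). -/
def CountableFanTightness : Prop := ∀ y : Y, SFin (Omega y) (Omega y)

/-- The Reznichenko property (at every point). -/
def ReznichenkoProperty : Prop := ∀ y : Y, ∀ A ∈ Omega y, A.Countable → A ∈ OmegaGp y

end Tightness

/-! ### Bornological covers

Mathlib's `Bornology X` is used for an arbitrary bornology `𝔅` on `X` (a hereditary cover of `X` that
is closed under finite unions); `Bornology.IsBounded` with respect to `𝔅` means membership in `𝔅`.
It is unrelated to the bornology of metrically bounded sets. -/

section Covers

variable {X : Type u} [MetricSpace X]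

/-- `B ∈ 𝔅`. -/
abbrev Mem {X : Type u} (𝔅 : Bornology X) (B : Set X) : Prop := @Bornology.IsBounded X 𝔅 B

/-- The bornology `𝔅` has a base of compact sets. -/
def HasCompactBase (𝔅 : Bornology X) : Prop :=
  ∃ 𝔅₀ : Set (Set X), (∀ K ∈ 𝔅₀, Mem 𝔅 K ∧ IsCompact K) ∧ ∀ B, Mem 𝔅 B → ∃ K ∈ 𝔅₀, B ⊆ K

/-- Open strong `𝔅`-covers; `Metric.thickening δ B` is the union of the open balls `S(x, δ)`, `x ∈ B`.
Such a family covers `X`, since singletons belong to `𝔅`. -/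
def IsOpenStrongCover (𝔅 : Bornology X) (𝒰 : Set (Set X)) : Prop :=
  (∀ U ∈ 𝒰, IsOpen U) ∧ univ ∉ 𝒰 ∧
    ∀ B, Mem 𝔅 B → ∃ U ∈ 𝒰, ∃ δ : ℝ, 0 < δ ∧ Metric.thickening δ B ⊆ U

/-- The strong `𝔅`-Hurewicz property. -/
def StrongHurewicz (𝔅 : Bornology X) : Prop :=
  ∀ 𝒰 : ℕ → Set (Set X), (∀ n, IsOpenStrongCover 𝔅 (𝒰 n)) →
    ∃ 𝒱 : ℕ → Set (Set X), (∀ n, (𝒱 n).Finite ∧ 𝒱 n ⊆ 𝒰 n) ∧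
      ∀ B, Mem 𝔅 B → ∃ n₀ : ℕ, ∃ δ : ℕ → ℝ, ∀ n ≥ n₀, 0 < δ n ∧
        ∃ U ∈ 𝒱 n, Metric.thickening (δ n) B ⊆ U

end Covers

/-- The product bornology `𝔅ⁿ` on `Xⁿ`; its members are the subsets of the sets `Bⁿ`, `B ∈ 𝔅`
(see `mem_power`). The space `Fin n → X` carries the maximum metric. -/
@[reducible] def power {X : Type u} (𝔅 : Bornology X) (n : ℕ) : Bornology (Fin n → X) :=
  @Pi.instBornology (Fin n) (fun _ => X) (fun _ => 𝔅)

theorem mem_power {X : Type u} (𝔅 : Bornology X) (n : ℕ) (C : Set (Fin n → X)) :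
    Mem (power 𝔅 n) C ↔ ∃ B, Mem 𝔅 B ∧ C ⊆ {x | ∀ i, x i ∈ B} := by
  unfold Mem power
  constructor
  · intro h
    refine ⟨⋃ i, (fun x : Fin n → X => x i) '' C, ?_, ?_⟩
    · rw [Bornology.isBounded_iUnion]
      exact Bornology.forall_isBounded_image_eval_iff.2 h
    · intro x hx i
      exact mem_iUnion.2 ⟨i, x, hx, rfl⟩
  · rintro ⟨B, hB, hC⟩
    refine Bornology.forall_isBounded_image_eval_iff.1 fun i => hB.subset ?_
    rintro _ ⟨x, hx, rfl⟩
    exact hC hx i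

/-! ### The function space `(C(X), τ^s_𝔅)` -/

section FunctionSpace

variable {X : Type u} [MetricSpace X]

/-- The basic entourage `[B, ε]^s` on `C(X)`. -/
def entourage (B : Set X) (ε : ℝ) : Set (C(X, ℝ) × C(X, ℝ)) :=
  {p | ∃ δ : ℝ, 0 < δ ∧ ∀ x ∈ Metric.thickening δ B, dist (p.1 x) (p.2 x) < ε}

theorem entourage_mono {B B' : Set X} {ε ε' : ℝ} (hB : B ⊆ B') (hε : ε' ≤ ε) :
    entourage B' ε' ⊆ entourage B ε := by
  rintro p ⟨δ, hδ, h⟩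
  exact ⟨δ, hδ, fun x hx => (h x (Metric.thickening_subset_of_subset δ hB hx)).trans_le hε⟩

/-- The sets `[B, ε]^s`, `B ∈ 𝔅`, `ε > 0`, as a base of a filter. -/
def entourageBasis (𝔅 : Bornology X) : FilterBasis (C(X, ℝ) × C(X, ℝ)) where
  sets := {E | ∃ B ε, Mem 𝔅 B ∧ 0 < ε ∧ E = entourage B ε}
  nonempty := ⟨_, ∅, 1, @Bornology.isBounded_empty X 𝔅, one_pos, rfl⟩
  inter_sets := by
    rintro _ _ ⟨B, ε, hB, hε, rfl⟩ ⟨B', ε', hB', hε', rfl⟩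
    refine ⟨_, ⟨B ∪ B', min ε ε', ?_, lt_min hε hε', rfl⟩, subset_inter ?_ ?_⟩
    · exact (@Bornology.isBounded_union X 𝔅 B B').2 ⟨hB, hB'⟩
    · exact entourage_mono subset_union_left (min_le_left _ _)
    · exact entourage_mono subset_union_right (min_le_right _ _)

/-- `C(X)`, the set of continuous real functions on `X`, as the carrier of the topology of strong
uniform convergence on `𝔅` (a copy of `C(X, ℝ)`, without its compact-open topology). -/
def StrongC (_𝔅 : Bornology X) : Type u := C(X, ℝ)

noncomputable instance (𝔅 : Bornology X) : AddCommGroup (StrongC 𝔅) :=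
  inferInstanceAs (AddCommGroup C(X, ℝ))

/-- The uniformity of strong uniform convergence on `𝔅`; the induced topology is `τ^s_𝔅`. -/
instance (𝔅 : Bornology X) : UniformSpace (StrongC 𝔅) :=
  UniformSpace.ofCore <| UniformSpace.Core.mkOfBasis (α := C(X, ℝ)) (entourageBasis 𝔅)
    (by
      rintro _ ⟨B, ε, -, hε, rfl⟩ f
      exact ⟨1, one_pos, fun x _ => by simpa using hε⟩)
    (by
      rintro _ ⟨B, ε, hB, hε, rfl⟩
      refine ⟨_, ⟨B, ε, hB, hε, rfl⟩, ?_⟩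
      rintro p ⟨δ, hδ, h⟩
      exact ⟨δ, hδ, fun x hx => by simpa [dist_comm] using h x hx⟩)
    (by
      rintro _ ⟨B, ε, hB, hε, rfl⟩
      refine ⟨_, ⟨B, ε / 2, hB, half_pos hε, rfl⟩, ?_⟩
      rintro ⟨f, g⟩ ⟨k, ⟨δ, hδ, h⟩, ⟨δ', hδ', h'⟩⟩
      refine ⟨min δ δ', lt_min hδ hδ', fun x hx => ?_⟩
      have h1 := h x (Metric.thickening_mono (min_le_left _ _) B hx)
      have h2 := h' x (Metric.thickening_mono (min_le_right _ _) B hx)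
      calc dist (f x) (g x) ≤ dist (f x) (k x) + dist (k x) (g x) := dist_triangle _ _ _
        _ < ε / 2 + ε / 2 := add_lt_add h1 h2
        _ = ε := add_halves ε)

end FunctionSpace

end BornSel

/-!
Because `𝔅` has a compact base, thickenings can be dispensed with: an open strong cover is a family
of proper open sets such that every compact `K ∈ 𝔅` lies in one of them, and `τ^s_𝔅` is the topology
of uniform convergence on the compact members of `𝔅` (`HasCompactBase.mem_nhds_zero_iff`). Moreover
an open set around a compact cube `Kⁿ` contains the cube over a thickening of `K`, so all finite
powers are Hurewicz as soon as `X` is (`StrongHurewicz.power`).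

The Hurewicz property of `X`, applied to the covers by sets `{|f| < 1 / (n + 1)}`, `f ∈ A n`, says that
from sets `A n` accumulating at `0` one can select finite `F n ⊆ A n` such that every neighbourhood of
`0` meets all but finitely many `F n` (`StrongHurewicz.hurewiczSelection`). Such selections can be made
for countably many sets at once, in particular for all nodes of a countable tree. In the game, TWO
restricts ONE's moves to countable subsets that still accumulate at `0` and omit the points already
chosen; then only countably many positions matter, and selecting at all of them simultaneously
beats any strategy of ONE, TWO's moves themselves being the required disjoint groups
(`HurewiczSelection.not_oneHasWinningStrategy`).

Conversely, if ONE has no winning strategy then the selection principle holds, and applied to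
functions that are `1` off members of given covers it returns the Hurewicz property
(`strongHurewicz_of_sFin`). The function space is homogeneous, so the selection principle at `0` gives
it everywhere, where it splits into countable fan tightness and the Reznichenko property
(`fanTightness_and_reznichenko_iff`).
-/

namespace BornSel

universe v

/-! ### Compact bases -/

section CompactBase

variable {X : Type v} [MetricSpace X] {𝔅 : Bornology X}

theorem HasCompactBase.exists_compact (hbase : HasCompactBase 𝔅) {B : Set X} (hB : Mem 𝔅 B) :
    ∃ K, Mem 𝔅 K ∧ IsCompact K ∧ B ⊆ K := by
  obtain ⟨𝔅₀, h₀, h₁⟩ := hbase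
  obtain ⟨K, hK, hBK⟩ := h₁ B hB
  exact ⟨K, (h₀ K hK).1, (h₀ K hK).2, hBK⟩

theorem HasCompactBase.power (hbase : HasCompactBase 𝔅) (n : ℕ) :
    HasCompactBase (power 𝔅 n) := by
  refine ⟨{C | Mem (BornSel.power 𝔅 n) C ∧ IsCompact C}, fun K hK => hK, fun C hC => ?_⟩
  obtain ⟨B, hB, hCB⟩ := (mem_power 𝔅 n C).1 hC
  obtain ⟨K, hK, hKc, hBK⟩ := hbase.exists_compact hB
  refine ⟨{x | ∀ i, x i ∈ K}, ⟨(mem_power 𝔅 n _).2 ⟨K, hK, subset_rfl⟩, ?_⟩,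
    fun x hx i => hBK (hCB hx i)⟩
  exact isCompact_pi_infinite fun _ => hKc

/-- Over a compact base the thickenings in the definition of a strong cover come for free. -/
theorem HasCompactBase.isOpenStrongCover (hbase : HasCompactBase 𝔅) {𝒰 : Set (Set X)}
    (hopen : ∀ U ∈ 𝒰, IsOpen U) (huniv : univ ∉ 𝒰)
    (hcover : ∀ K, Mem 𝔅 K → IsCompact K → ∃ U ∈ 𝒰, K ⊆ U) : IsOpenStrongCover 𝔅 𝒰 := by
  refine ⟨hopen, huniv, fun B hB => ?_⟩
  obtain ⟨K, hK, hKc, hBK⟩ := hbase.exists_compact hB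
  obtain ⟨U, hU, hKU⟩ := hcover K hK hKc
  obtain ⟨δ, hδ, h⟩ := hKc.exists_thickening_subset_open (hopen U hU) hKU
  exact ⟨U, hU, δ, hδ, (Metric.thickening_subset_of_subset δ hBK).trans h⟩

theorem IsOpenStrongCover.exists_superset {𝒰 : Set (Set X)} (h : IsOpenStrongCover 𝔅 𝒰)
    {B : Set X} (hB : Mem 𝔅 B) : ∃ U ∈ 𝒰, B ⊆ U := by
  obtain ⟨U, hU, δ, hδ, hBU⟩ := h.2.2 B hB
  exact ⟨U, hU, (Metric.self_subset_thickening hδ B).trans hBU⟩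

/-- Over a compact base the strong Hurewicz property can be stated without thickenings. -/
theorem HasCompactBase.strongHurewicz_iff (hbase : HasCompactBase 𝔅) :
    StrongHurewicz 𝔅 ↔ ∀ 𝒰 : ℕ → Set (Set X), (∀ n, IsOpenStrongCover 𝔅 (𝒰 n)) →
      ∃ 𝒱 : ℕ → Set (Set X), (∀ n, (𝒱 n).Finite ∧ 𝒱 n ⊆ 𝒰 n) ∧
        ∀ B, Mem 𝔅 B → ∀ᶠ n in atTop, ∃ U ∈ 𝒱 n, B ⊆ U := by
  refine forall₂_congr fun 𝒰 h𝒰 => exists_congr fun 𝒱 => and_congr_right fun h𝒱 => ?_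
  constructor
  · intro h B hB
    obtain ⟨n₀, δ, hδ⟩ := h B hB
    filter_upwards [eventually_ge_atTop n₀] with n hn
    obtain ⟨hpos, U, hU, hBU⟩ := hδ n hn
    exact ⟨U, hU, (Metric.self_subset_thickening hpos B).trans hBU⟩
  · intro h B hB
    obtain ⟨K, hK, hKc, hBK⟩ := hbase.exists_compact hB
    obtain ⟨n₀, hn₀⟩ := eventually_atTop.1 (h K hK)
    have key : ∀ n, ∃ δ : ℝ, n₀ ≤ n → 0 < δ ∧ ∃ U ∈ 𝒱 n, Metric.thickening δ B ⊆ U := by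
      intro n
      by_cases hn : n₀ ≤ n
      · obtain ⟨U, hU, hKU⟩ := hn₀ n hn
        obtain ⟨δ, hδ, h⟩ :=
          hKc.exists_thickening_subset_open ((h𝒰 n).1 U ((h𝒱 n).2 hU)) hKU
        exact ⟨δ, fun _ => ⟨hδ, U, hU, (Metric.thickening_subset_of_subset δ hBK).trans h⟩⟩
      · exact ⟨0, fun h => absurd h hn⟩
    choose δ hδ using key
    exact ⟨n₀, δ, hδ⟩

end CompactBase

/-! ### Finite powers -/

section Powers

variable {X : Type v} [MetricSpace X] {𝔅 : Bornology X}

/-- A cover of `Xⁿ` is refined by the cubes `Vⁿ` over a cover of `X`: a neighbourhood of the compact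
cube `Kⁿ` contains the cube over a thickening of `K`. -/
theorem StrongHurewicz.power (hbase : HasCompactBase 𝔅) (h : StrongHurewicz 𝔅) (n : ℕ) :
    StrongHurewicz (power 𝔅 n) := by
  rw [(hbase.power n).strongHurewicz_iff]
  intro 𝒰 h𝒰
  obtain ⟨𝒱, h𝒱, hev⟩ := hbase.strongHurewicz_iff.1 h
    (fun k => {V | IsOpen V ∧ ∃ U ∈ 𝒰 k, {x : Fin n → X | ∀ i, x i ∈ V} ⊆ U}) (by
      intro k
      refine hbase.isOpenStrongCover (fun V hV => hV.1) ?_ ?_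
      · rintro ⟨-, U, hU, hsub⟩
        have : U = univ := univ_subset_iff.1 fun x _ => hsub fun i => mem_univ (x i)
        exact (h𝒰 k).2.1 (this ▸ hU)
      · intro K hK hKc
        obtain ⟨U, hU, hKU⟩ := (h𝒰 k).exists_superset
          ((mem_power 𝔅 n {x | ∀ i, x i ∈ K}).2 ⟨K, hK, subset_rfl⟩)
        have hc : IsCompact {x : Fin n → X | ∀ i, x i ∈ K} := isCompact_pi_infinite fun _ => hKc
        obtain ⟨δ, hδ, hsub⟩ := hc.exists_thickening_subset_open ((h𝒰 k).1 U hU) hKU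
        refine ⟨Metric.thickening δ K, ⟨Metric.isOpen_thickening, U, hU, fun x hx => hsub ?_⟩,
          Metric.self_subset_thickening hδ K⟩
        choose z hzK hz using fun i => Metric.mem_thickening_iff.1 (hx i)
        exact Metric.mem_thickening_iff.2 ⟨z, hzK, (dist_pi_lt_iff hδ).2 hz⟩)
  choose g hg𝒰 hg using fun k (V : 𝒱 k) => ((h𝒱 k).2 V.2).2
  refine ⟨fun k => range (g k), fun k => ⟨?_, range_subset_iff.2 (hg𝒰 k)⟩, fun C hC => ?_⟩
  · have := (h𝒱 k).1.to_subtype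
    exact finite_range _
  · obtain ⟨B, hB, hCB⟩ := (mem_power 𝔅 n C).1 hC
    filter_upwards [hev B hB] with k ⟨V, hV, hBV⟩
    exact ⟨g k ⟨V, hV⟩, mem_range_self _, fun x hx => hg k ⟨V, hV⟩ fun i => hBV (hCB hx i)⟩

theorem StrongHurewicz.of_power_one (hbase : HasCompactBase 𝔅)
    (h : StrongHurewicz (BornSel.power 𝔅 1)) : StrongHurewicz 𝔅 := by
  rw [hbase.strongHurewicz_iff]
  intro 𝒰 h𝒰
  obtain ⟨𝒱, h𝒱, hev⟩ := (hbase.power 1).strongHurewicz_iff.1 h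
    (fun k => (fun U : Set X => {x : Fin 1 → X | x 0 ∈ U}) '' 𝒰 k) (by
      intro k
      refine (hbase.power 1).isOpenStrongCover ?_ ?_ ?_
      · rintro _ ⟨U, hU, rfl⟩
        exact ((h𝒰 k).1 U hU).preimage (continuous_apply 0)
      · rintro ⟨U, hU, hUu⟩
        have : U = univ := univ_subset_iff.1 fun x _ => by
          have : (fun _ => x : Fin 1 → X) ∈ {x : Fin 1 → X | x 0 ∈ U} := by
            rw [show {x : Fin 1 → X | x 0 ∈ U} = univ from hUu]; trivial
          exact this
        exact (h𝒰 k).2.1 (this ▸ hU)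
      · intro C hC _
        obtain ⟨B, hB, hCB⟩ := (mem_power 𝔅 1 C).1 hC
        obtain ⟨U, hU, hBU⟩ := (h𝒰 k).exists_superset hB
        exact ⟨_, mem_image_of_mem _ hU, fun x hx => hBU (hCB hx 0)⟩)
  have key : ∀ k, ∃ 𝒲 ⊆ 𝒰 k, 𝒲.Finite ∧
      𝒱 k = (fun U : Set X => {x : Fin 1 → X | x 0 ∈ U}) '' 𝒲 := fun k =>
    exists_subset_image_finite_and.1 ⟨𝒱 k, (h𝒱 k).2, (h𝒱 k).1, rfl⟩
  choose 𝒲 h𝒲 hfin him using key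
  refine ⟨𝒲, fun k => ⟨hfin k, h𝒲 k⟩, fun B hB => ?_⟩
  filter_upwards [hev {x | ∀ i, x i ∈ B} ((mem_power 𝔅 1 _).2 ⟨B, hB, subset_rfl⟩)]
    with k ⟨V, hV, hBV⟩
  rw [him k] at hV
  obtain ⟨U, hU, rfl⟩ := hV
  exact ⟨U, hU, fun x hx => hBV (show (fun _ => x : Fin 1 → X) ∈ _ from fun _ => hx)⟩

end Powers

/-! ### Selections at a point of a topological space -/

section Selections

variable {Y Z : Type v} [TopologicalSpace Y] [TopologicalSpace Z] {y : Y}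

theorem image_mem_Omega (e : Y ≃ₜ Z) {A : Set Y} (hA : A ∈ Omega y) : e '' A ∈ Omega (e y) := by
  refine ⟨?_, fun h => hA.2 ((e.injective.mem_set_image).1 h)⟩
  rw [← e.image_closure]
  exact mem_image_of_mem e hA.1

theorem image_mem_OmegaGp (e : Y ≃ₜ Z) {A : Set Y} (hA : A ∈ OmegaGp y) :
    e '' A ∈ OmegaGp (e y) := by
  obtain ⟨hΩ, hc, P, hfin, hdisj, hun, hmeet⟩ := hA
  refine ⟨image_mem_Omega e hΩ, hc.image e, fun n => e '' P n, fun n => (hfin n).image e,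
    fun m n hmn => (disjoint_image_iff e.injective).2 (hdisj m n hmn), ?_, fun W hW => ?_⟩
  · rw [← image_iUnion, hun]
  · filter_upwards [hmeet _ (e.continuous.continuousAt hW)] with n ⟨p, hpW, hp⟩
    exact ⟨e p, hpW, mem_image_of_mem e hp⟩

theorem sFin_OmegaGp_of_homeomorph (e : Y ≃ₜ Z)
    (h : SFin (Omega (e y)) (OmegaGp (e y))) : SFin (Omega y) (OmegaGp y) := by
  intro A hA
  obtain ⟨F, hF, hgp⟩ := h (fun n => e '' A n) fun n => image_mem_Omega e (hA n)
  refine ⟨fun n => e.symm '' F n, fun n => ⟨(hF n).1.image _, ?_⟩, ?_⟩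
  · rintro _ ⟨z, hz, rfl⟩
    obtain ⟨x, hx, rfl⟩ := (hF n).2 hz
    simpa using hx
  · simpa [image_iUnion] using image_mem_OmegaGp e.symm hgp

/-- Distributing the countably many elements of `A` outside a groupable subset over the groups,
one for each group, makes `A` itself groupable. -/
theorem mem_OmegaGp_of_subset {A B : Set Y} (hB : B ∈ OmegaGp y) (hBA : B ⊆ A)
    (hA : A ∈ Omega y) (hc : A.Countable) : A ∈ OmegaGp y := by
  obtain ⟨-, -, P, hfin, hdisj, hun, hmeet⟩ := hB
  obtain ⟨f, hf⟩ := countable_iff_exists_injOn.1 (hc.mono (sdiff_subset (t := B)))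
  have hPB : ∀ n, P n ⊆ B := fun n => hun ▸ subset_iUnion P n
  refine ⟨hA, hc, fun n => P n ∪ {a | a ∈ A \ B ∧ f a = n}, fun n => (hfin n).union ?_, ?_, ?_, ?_⟩
  · exact Set.Subsingleton.finite fun a ha b hb => hf ha.1 hb.1 (ha.2.trans hb.2.symm)
  · intro m n hmn
    rw [disjoint_left]
    rintro x (hx | hx) (hx' | hx')
    · exact disjoint_left.1 (hdisj m n hmn) hx hx'
    · exact hx'.1.2 (hPB m hx)
    · exact hx.1.2 (hPB n hx')
    · exact hmn (hx.2.symm.trans hx'.2)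
  · rw [iUnion_union_distrib, hun]
    ext x
    simp only [mem_union, mem_iUnion, mem_ofPred_eq]
    constructor
    · rintro (hx | ⟨_, hx, -⟩)
      exacts [hBA hx, hx.1]
    · intro hx
      by_cases hxB : x ∈ B
      exacts [Or.inl hxB, Or.inr ⟨_, ⟨hx, hxB⟩, rfl⟩]
  · intro W hW
    filter_upwards [hmeet W hW] with n hn
    exact hn.mono (inter_subset_inter_right W subset_union_left)

/-- Fan tightness and the Reznichenko property together amount to a single selection principle. -/
theorem fanTightness_and_reznichenko_iff :
    (CountableFanTightness Y ∧ ReznichenkoProperty Y) ↔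
      ∀ y : Y, SFin (Omega y) (OmegaGp y) := by
  constructor
  · rintro ⟨ht, hr⟩ y A hA
    obtain ⟨F, hF, hΩ⟩ := ht y A hA
    exact ⟨F, hF, hr y _ hΩ (countable_iUnion fun n => (hF n).1.countable)⟩
  · intro h
    refine ⟨fun y A hA => ?_, fun y A hA hc => ?_⟩
    · obtain ⟨F, hF, hgp⟩ := h y A hA
      exact ⟨F, hF, hgp.1⟩
    · obtain ⟨F, hF, hgp⟩ := h y (fun _ => A) fun _ => hA
      exact mem_OmegaGp_of_subset hgp (iUnion_subset fun n => (hF n).2) hA hc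

/-- ONE may ignore TWO's moves, so the game principle implies the selection principle. -/
theorem sFin_of_not_oneHasWinningStrategy {S : Type v} {𝒜 ℬ : Set (Set S)}
    (h : ¬ OneHasWinningStrategyGFin 𝒜 ℬ) : SFin 𝒜 ℬ := by
  intro A hA
  by_contra hno
  refine h ⟨fun l => A l.length, fun l => hA _, fun F hF hmem => hno ⟨F, fun n => ?_, hmem⟩⟩
  simpa using hF n

/-- From countably many sets that accumulate at `y` one can select finite subsets such that every
neighbourhood of `y` meets all but finitely many of them. -/
def HurewiczSelection (y : Y) : Prop :=
  ∀ A : ℕ → Set Y, (∀ n, y ∈ closure (A n)) →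
    ∃ F : ℕ → Set Y, (∀ n, (F n).Finite ∧ F n ⊆ A n) ∧
      ∀ W ∈ 𝓝 y, ∀ᶠ n in atTop, (W ∩ F n).Nonempty

theorem HurewiczSelection.exists_countable (h : HurewiczSelection y) {A : Set Y}
    (hA : y ∈ closure A) : ∃ D ⊆ A, D.Countable ∧ y ∈ closure D := by
  obtain ⟨F, hF, hmeet⟩ := h (fun _ => A) fun _ => hA
  refine ⟨⋃ n, F n, iUnion_subset fun n => (hF n).2, countable_iUnion fun n => (hF n).1.countable,
    mem_closure_iff_nhds.2 fun W hW => ?_⟩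
  obtain ⟨n, x, hxW, hx⟩ := (hmeet W hW).exists
  exact ⟨x, hxW, mem_iUnion.2 ⟨n, hx⟩⟩

theorem HurewiczSelection.of_denumerable (h : HurewiczSelection y) {ι : Type*} [Denumerable ι]
    {A : ι → Set Y} (hA : ∀ i, y ∈ closure (A i)) :
    ∃ F : ι → Set Y, (∀ i, (F i).Finite ∧ F i ⊆ A i) ∧
      ∀ W ∈ 𝓝 y, ∀ᶠ i in cofinite, (W ∩ F i).Nonempty := by
  let e := Denumerable.eqv ι
  obtain ⟨F, hF, hmeet⟩ := h (fun n => A (e.symm n)) fun n => hA _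
  refine ⟨fun i => F (e i), fun i => by simpa using hF (e i), fun W hW => ?_⟩
  have := hmeet W hW
  rw [← Nat.cofinite_eq_atTop] at this
  exact e.injective.tendsto_cofinite.eventually this

/-- If TWO only draws from a countable set `D`, the possible moves can be numbered. -/
theorem exists_enum_finite_subsets {S : Type v} {D : Set S} (hD : D.Countable) :
    ∃ g : ℕ → Set S, ∀ F : Set S, F.Finite → F ⊆ D → ∃ j, g j = F := by
  obtain ⟨g, hg⟩ := (countable_ofPred_finite_subset hD).exists_eq_range
    ⟨∅, finite_empty, empty_subset D⟩
  exact ⟨g, fun F hF hFD => by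
    have : F ∈ range g := hg ▸ (⟨hF, hFD⟩ : F ∈ {t | t.Finite ∧ t ⊆ D})
    exact this⟩

/-- TWO only considers finite subsets of a countable part of ONE's move from which the points chosen
earlier have been removed. The positions that arise form a countable tree, so one selection made
simultaneously at all its nodes is a strategy for TWO: a play visits infinitely many nodes and
hence all but finitely many of its moves meet a given neighbourhood. -/
theorem HurewiczSelection.not_oneHasWinningStrategy [T1Space Y] (h : HurewiczSelection y) :
    ¬ OneHasWinningStrategyGFin (Omega y) (OmegaGp y) := by
  rintro ⟨σ, hσ, hwin⟩
  have hdel : ∀ l : List (Set Y), ∃ D : Set Y, ∃ g : ℕ → Set Y, y ∈ closure D ∧ D ⊆ σ l ∧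
      ((∀ F ∈ l, F.Finite) → ∀ F ∈ l, Disjoint D F) ∧
      ∀ F : Set Y, F.Finite → F ⊆ D → ∃ j, g j = F := by
    intro l
    by_cases hl : ∀ F ∈ l, F.Finite
    · have hfin : (σ l ∩ ⋃ F ∈ l, F).Finite := by
        refine Finite.inter_of_right ?_ _
        exact Finite.biUnion (List.finite_toSet l) hl
      have hy : y ∈ closure (σ l \ (σ l ∩ ⋃ F ∈ l, F)) := by
        refine mem_closure_iff_nhds.2 fun W hW => ?_
        have hW' : W ∩ (σ l ∩ ⋃ F ∈ l, F)ᶜ ∈ 𝓝 y :=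
          inter_mem hW (hfin.isClosed.isOpen_compl.mem_nhds fun hy => (hσ l).2 hy.1)
        obtain ⟨x, ⟨hxW, hxn⟩, hx⟩ := mem_closure_iff_nhds.1 (hσ l).1 _ hW'
        exact ⟨x, hxW, hx, hxn⟩
      obtain ⟨D, hD, hDc, hyD⟩ := h.exists_countable hy
      obtain ⟨g, hg⟩ := exists_enum_finite_subsets hDc
      refine ⟨D, g, hyD, fun x hx => (hD hx).1, fun _ F hF => disjoint_left.2 fun x hx hxF => ?_, hg⟩
      exact (hD hx).2 ⟨(hD hx).1, mem_iUnion₂.2 ⟨F, hF, hxF⟩⟩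
    · obtain ⟨D, hD, hDc, hyD⟩ := h.exists_countable (hσ l).1
      obtain ⟨g, hg⟩ := exists_enum_finite_subsets hDc
      exact ⟨D, g, hyD, hD, fun h => absurd h hl, hg⟩
  choose D g hyD hDσ hdisj hg using hdel
  -- A list of indices, the latest first, encodes a position.
  let pos : List ℕ → List (Set Y) := fun s => s.rec [] fun j _ l => l ++ [g l j]
  obtain ⟨F, hF, hmeet⟩ := h.of_denumerable (A := fun s : List ℕ => D (pos s)) fun s => hyD _
  choose j hj using fun s => hg (pos s) (F s) (hF s).1 (hF s).2
  let node : ℕ → List ℕ := fun n => n.rec [] fun _ s => j s :: s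
  let play : ℕ → Set Y := fun n => F (node n)
  have hlen : ∀ n, (node n).length = n := by
    intro n
    induction n with
    | zero => rfl
    | succ n ih => exact congrArg (· + 1) ih
  have hinj : Function.Injective node := fun m n hmn => by
    rw [← hlen m, hmn, hlen]
  have hpos : ∀ n, pos (node n) = (List.range n).map play := by
    intro n
    induction n with
    | zero => rfl
    | succ n ih =>
      rw [List.range_succ, List.map_append, ← ih]
      exact congrArg (fun G => pos (node n) ++ [G]) (hj (node n))
  have hplayfin : ∀ n, (play n).Finite := fun n => (hF _).1
  have hplay : ∀ n, play n ⊆ D ((List.range n).map play) := fun n => hpos n ▸ (hF _).2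
  have hlegal : ∀ n, play n ⊆ σ ((List.range n).map play) := fun n => (hplay n).trans (hDσ _)
  have hev : ∀ W ∈ 𝓝 y, ∀ᶠ n in atTop, (W ∩ play n).Nonempty := fun W hW => by
    rw [← Nat.cofinite_eq_atTop]
    exact hinj.tendsto_cofinite.eventually (hmeet W hW)
  have hlt : ∀ m n, m < n → Disjoint (play m) (play n) := fun m n hmn => by
    refine (Disjoint.mono_left (hplay n) (hdisj _ ?_ (play m) ?_)).symm
    · intro G hG
      obtain ⟨k, -, rfl⟩ := List.mem_map.1 hG
      exact hplayfin k
    · exact List.mem_map.2 ⟨m, List.mem_range.2 hmn, rfl⟩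
  refine hwin play (fun n => ⟨hplayfin n, hlegal n⟩) ⟨⟨?_, ?_⟩,
    countable_iUnion fun n => (hplayfin n).countable, play, hplayfin, ?_, rfl, hev⟩
  · refine mem_closure_iff_nhds.2 fun W hW => ?_
    obtain ⟨n, x, hxW, hx⟩ := (hev W hW).exists
    exact ⟨x, hxW, mem_iUnion.2 ⟨n, hx⟩⟩
  · intro hy
    obtain ⟨n, hn⟩ := mem_iUnion.1 hy
    exact (hσ _).2 (hlegal n hn)
  · intro m n hmn
    rcases hmn.lt_or_gt with hmn | hmn
    exacts [hlt m n hmn, (hlt n m hmn).symm]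

end Selections

/-! ### The function space over a compact base -/

section StrongC

variable {X : Type v} [MetricSpace X] {𝔅 : Bornology X}

/-- An element of `StrongC 𝔅` as a continuous map, to be evaluated at points. -/
def StrongC.toMap (f : StrongC 𝔅) : C(X, ℝ) := f

theorem StrongC.mem_uniformity_iff {V : Set (StrongC 𝔅 × StrongC 𝔅)} :
    V ∈ uniformity (StrongC 𝔅) ↔ ∃ B ε, Mem 𝔅 B ∧ 0 < ε ∧ entourage B ε ⊆ V := by
  have h : V ∈ uniformity (StrongC 𝔅) ↔ ∃ s ∈ entourageBasis 𝔅, s ⊆ V :=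
    (entourageBasis 𝔅).mem_filter_iff
  rw [h]
  constructor
  · rintro ⟨_, ⟨B, ε, hB, hε, rfl⟩, hV⟩
    exact ⟨B, ε, hB, hε, hV⟩
  · rintro ⟨B, ε, hB, hε, hV⟩
    exact ⟨_, ⟨B, ε, hB, hε, rfl⟩, hV⟩

/-- Over a compact base, `τ^s_𝔅` is the topology of uniform convergence on the compact members. -/
theorem HasCompactBase.mem_nhds_zero_iff (hbase : HasCompactBase 𝔅) {W : Set (StrongC 𝔅)} :
    W ∈ 𝓝 0 ↔ ∃ K ε, Mem 𝔅 K ∧ IsCompact K ∧ 0 < ε ∧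
      {f : StrongC 𝔅 | ∀ x ∈ K, |f.toMap x| < ε} ⊆ W := by
  rw [UniformSpace.mem_nhds_iff]
  have hdist : ∀ (f : StrongC 𝔅) x, dist ((0 : C(X, ℝ)) x) (f.toMap x) = |f.toMap x| := fun f x => by
    simp [Real.dist_eq]
  constructor
  · rintro ⟨V, hV, hVW⟩
    obtain ⟨B, ε, hB, hε, hBV⟩ := StrongC.mem_uniformity_iff.1 hV
    obtain ⟨K, hK, hKc, hBK⟩ := hbase.exists_compact hB
    refine ⟨K, ε, hK, hKc, hε, fun f hf => hVW (hBV ?_)⟩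
    obtain ⟨δ, hδ, h⟩ := hKc.exists_thickening_subset_open
      (isOpen_lt (f.toMap.continuous.abs) continuous_const) (show K ⊆ {x | |f.toMap x| < ε} from hf)
    exact ⟨δ, hδ, fun x hx =>
      (hdist f x).trans_lt (h (Metric.thickening_subset_of_subset δ hBK hx))⟩
  · rintro ⟨K, ε, hK, -, hε, hW⟩
    refine ⟨entourage K ε, StrongC.mem_uniformity_iff.2 ⟨K, ε, hK, hε, subset_rfl⟩, ?_⟩
    rintro f ⟨δ, hδ, h⟩
    exact hW fun x hx => (hdist f x).symm.trans_lt (h x (Metric.self_subset_thickening hδ K hx))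

theorem StrongC.uniformContinuous_add_right (c : StrongC 𝔅) :
    UniformContinuous fun f : StrongC 𝔅 => f + c := by
  intro V hV
  obtain ⟨B, ε, hB, hε, hBV⟩ := StrongC.mem_uniformity_iff.1 hV
  refine StrongC.mem_uniformity_iff.2 ⟨B, ε, hB, hε, ?_⟩
  rintro ⟨f, g⟩ ⟨δ, hδ, h⟩
  exact hBV ⟨δ, hδ, fun x hx => (dist_add_right (f x) (g x) (c.toMap x)).trans_lt (h x hx)⟩

/-- Translation by `c`. -/
noncomputable def StrongC.addRight (c : StrongC 𝔅) : StrongC 𝔅 ≃ₜ StrongC 𝔅 where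
  toEquiv := Equiv.addRight c
  continuous_toFun := (StrongC.uniformContinuous_add_right c).continuous
  continuous_invFun := (StrongC.uniformContinuous_add_right (-c)).continuous

theorem StrongC.sFin_OmegaGp (h : SFin (Omega (0 : StrongC 𝔅)) (OmegaGp (0 : StrongC 𝔅)))
    (y : StrongC 𝔅) : SFin (Omega y) (OmegaGp y) := by
  have hy : StrongC.addRight (-y) y = 0 := add_neg_cancel y
  refine sFin_OmegaGp_of_homeomorph (StrongC.addRight (-y)) ?_
  rwa [hy]

/-- Singletons belong to `𝔅`, so distinct functions are separated. -/
instance : T1Space (StrongC 𝔅) := by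
  refine ((t1Space_TFAE (StrongC 𝔅)).out 0 5).2 fun f g hfg => ?_
  have hfg' : f.toMap ≠ g.toMap := hfg
  obtain ⟨x, hx⟩ := DFunLike.ne_iff.1 hfg'
  refine ⟨_, UniformSpace.ball_mem_nhds f (StrongC.mem_uniformity_iff.2 ⟨{x},
    dist (f.toMap x) (g.toMap x), @Bornology.isBounded_singleton X 𝔅 x, dist_pos.2 hx,
    subset_rfl⟩), ?_⟩
  rintro ⟨δ, hδ, h⟩
  exact lt_irrefl _ (h x (Metric.self_subset_thickening hδ _ rfl))

/-- The sets `{|f| < ε}` with `f ∈ A` form a cover if `A` accumulates at `0` and no `f ∈ A` satisfies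
`|f| < ε` everywhere. Indices `n` at which the latter fails need no selection. -/
theorem StrongHurewicz.hurewiczSelection (hbase : HasCompactBase 𝔅) (hproper : ¬ Mem 𝔅 univ)
    (h : StrongHurewicz 𝔅) : HurewiczSelection (0 : StrongC 𝔅) := by
  intro A hA
  let ε : ℕ → ℝ := fun n => 1 / ((n : ℝ) + 1)
  have hε : ∀ n, 0 < ε n := fun n => Nat.one_div_pos_of_nat
  let small : ℕ → StrongC 𝔅 → Set X := fun n f => {x | |f.toMap x| < ε n}
  have hopen : ∀ n f, IsOpen (small n f) := fun n f =>
    isOpen_lt (f.toMap.continuous.abs) continuous_const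
  have hsel : ∃ 𝒱 : ℕ → Set (Set X),
      (∀ n, (𝒱 n).Finite ∧ (univ ∉ small n '' A n → 𝒱 n ⊆ small n '' A n)) ∧
        ∀ B, Mem 𝔅 B → ∀ᶠ n in atTop, ∃ U ∈ 𝒱 n, B ⊆ U := by
    obtain ⟨𝒱, h𝒱, hev⟩ := hbase.strongHurewicz_iff.1 h
      (fun n => {U | IsOpen U ∧ U ≠ univ ∧ (univ ∉ small n '' A n → U ∈ small n '' A n)}) (by
        intro n
        refine hbase.isOpenStrongCover (fun U hU => hU.1) (fun hU => hU.2.1 rfl) ?_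
        intro K hK hKc
        by_cases hn : univ ∈ small n '' A n
        · have hKu : K ≠ univ := fun hK' => hproper (hK' ▸ hK)
          obtain ⟨x, hx⟩ := (ne_univ_iff_exists_notMem K).1 hKu
          exact ⟨{x}ᶜ, ⟨isOpen_compl_singleton, fun hu => by
            have : x ∈ ({x}ᶜ : Set X) := hu ▸ mem_univ x
            exact this rfl, fun h => absurd hn h⟩, fun z hz hzx => hx (hzx ▸ hz)⟩
        · obtain ⟨f, hfK, hfA⟩ := mem_closure_iff_nhds.1 (hA n) _
            (hbase.mem_nhds_zero_iff.2 ⟨K, ε n, hK, hKc, hε n, subset_rfl⟩)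
          have hf : small n f ∈ small n '' A n := mem_image_of_mem _ hfA
          exact ⟨small n f, ⟨hopen n f, fun hu => hn (hu ▸ hf), fun _ => hf⟩, hfK⟩)
    exact ⟨𝒱, fun n => ⟨(h𝒱 n).1, fun hn U hU => ((h𝒱 n).2 hU).2.2 hn⟩, hev⟩
  obtain ⟨𝒱, h𝒱, hev⟩ := hsel
  have key : ∀ n, ∃ F ⊆ A n, F.Finite ∧ ∀ B, (∃ U ∈ 𝒱 n, B ⊆ U) → ∃ f ∈ F, B ⊆ small n f := by
    intro n
    by_cases hn : univ ∈ small n '' A n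
    · obtain ⟨f, hf, hfu⟩ := hn
      exact ⟨{f}, singleton_subset_iff.2 hf, finite_singleton f, fun B _ =>
        ⟨f, rfl, hfu ▸ subset_univ B⟩⟩
    · obtain ⟨F, hFA, hF, him⟩ : ∃ F ⊆ A n, F.Finite ∧ 𝒱 n = small n '' F :=
        exists_subset_image_finite_and.1 ⟨𝒱 n, (h𝒱 n).2 hn, (h𝒱 n).1, rfl⟩
      refine ⟨F, hFA, hF, ?_⟩
      rintro B ⟨U, hU, hBU⟩
      rw [him] at hU
      obtain ⟨f, hf, rfl⟩ := hU
      exact ⟨f, hf, hBU⟩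
  choose F hFA hF hFB using key
  refine ⟨F, fun n => ⟨hF n, hFA n⟩, fun W hW => ?_⟩
  obtain ⟨K, η, hK, -, hη, hKW⟩ := hbase.mem_nhds_zero_iff.1 hW
  have hlim : ∀ᶠ n in atTop, ε n < η :=
    tendsto_one_div_add_atTop_nhds_zero_nat.eventually_lt_const hη
  filter_upwards [hev K hK, hlim] with n hn hnη
  obtain ⟨f, hf, hKf⟩ := hFB n K hn
  exact ⟨f, hKW fun x hx => (hKf hx).trans hnη, hf⟩

/-- Given covers `𝒰 k`, the functions that for each `k ≤ n` are `1` off a member of `𝒰 k`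
accumulate at `0`. A group of a groupable selection from these sets that avoids the first `k`
selections consists of functions which are `1` off members of `𝒰 k`. -/
theorem strongHurewicz_of_sFin (hbase : HasCompactBase 𝔅)
    (h : SFin (Omega (0 : StrongC 𝔅)) (OmegaGp (0 : StrongC 𝔅))) : StrongHurewicz 𝔅 := by
  rw [hbase.strongHurewicz_iff]
  intro 𝒰 h𝒰
  obtain ⟨F, hF, -, -, P, hPfin, hPdisj, hPun, hPmeet⟩ := h
    (fun n => {f | ∀ k ≤ n, ∃ U ∈ 𝒰 k, ∀ x ∉ U, f.toMap x = 1}) (by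
      refine fun n => ⟨mem_closure_iff_nhds.2 fun W hW => ?_, fun h0 => ?_⟩
      · obtain ⟨K, ε, hK, hKc, hε, hKW⟩ := hbase.mem_nhds_zero_iff.1 hW
        choose U hU hKU using fun k => (h𝒰 k).exists_superset hK
        have hopen : IsOpen (⋂ k ∈ Iic n, U k) :=
          (finite_Iic n).isOpen_biInter fun k _ => (h𝒰 k).1 _ (hU k)
        obtain ⟨f, hf0, hf1, -⟩ := exists_continuous_zero_one_of_isClosed hKc.isClosed
          hopen.isClosed_compl
          (disjoint_compl_right_iff_subset.2 (subset_iInter₂ fun k _ => hKU k))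
        refine ⟨(f : StrongC 𝔅), hKW fun x hx => ?_, fun k hk => ⟨U k, hU k, fun x hx => ?_⟩⟩
        · have : f x = 0 := hf0 hx
          change |f x| < ε
          rwa [this, abs_zero]
        · exact hf1 fun hx' => hx (mem_iInter₂.1 hx' k hk)
      · obtain ⟨U, hU, hU1⟩ := h0 0 (Nat.zero_le n)
        have : U = univ := eq_univ_of_forall fun x => by
          by_contra hx
          exact zero_ne_one (hU1 x hx)
        exact (h𝒰 0).2.1 (this ▸ hU))
  -- Disjoint groups eventually avoid the finite set of the functions selected before step `k`.
  have hm : ∀ k, ∃ m ≥ k, ∀ f ∈ P m, ∃ U ∈ 𝒰 k, ∀ x ∉ U, f.toMap x = 1 := by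
    intro k
    have hfin : (⋃ n ∈ Iio k, F n).Finite := (finite_Iio k).biUnion fun n _ => (hF n).1
    have hhit : {m | ((⋃ n ∈ Iio k, F n) ∩ P m).Nonempty}.Finite := by
      choose! g hg using fun m
        (hm : m ∈ {m | ((⋃ n ∈ Iio k, F n) ∩ P m).Nonempty}) => hm
      refine Finite.of_injOn (fun m hm => (hg m hm).1) (fun m hm n hn hmn => ?_) hfin
      by_contra hne
      exact disjoint_left.1 (hPdisj m n hne) (hg m hm).2 (hmn ▸ (hg n hn).2)
    obtain ⟨m, hm⟩ := (hhit.union (finite_Iio k)).exists_notMem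
    refine ⟨m, not_lt.1 fun hmk => hm (Or.inr hmk), fun f hf => ?_⟩
    obtain ⟨n, hn⟩ := mem_iUnion.1 (hPun ▸ mem_iUnion.2 ⟨m, hf⟩ : f ∈ ⋃ n, F n)
    have hkn : k ≤ n := not_lt.1 fun hnk => hm (Or.inl ⟨f, mem_iUnion₂.2 ⟨n, hnk, hn⟩, hf⟩)
    exact (hF n).2 hn k hkn
  choose m hmk hm using hm
  choose U hU𝒰 hU using fun k (f : P (m k)) => hm k f.1 f.2
  refine ⟨fun k => range (U k), fun k => ⟨?_, range_subset_iff.2 (hU𝒰 k)⟩, fun B hB => ?_⟩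
  · have := (hPfin (m k)).to_subtype
    exact finite_range _
  · obtain ⟨K, hK, hKc, hBK⟩ := hbase.exists_compact hB
    have hW := hPmeet _ (hbase.mem_nhds_zero_iff.2 ⟨K, 1, hK, hKc, one_pos, subset_rfl⟩)
    filter_upwards [(tendsto_atTop_mono hmk tendsto_id).eventually hW] with k ⟨f, hfK, hf⟩
    refine ⟨U k ⟨f, hf⟩, mem_range_self _, fun x hx => ?_⟩
    by_contra hxU
    have h1 : |f.toMap x| < 1 := hfK x (hBK hx)
    rw [hU k ⟨f, hf⟩ x hxU, abs_one] at h1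
    exact lt_irrefl _ h1

end StrongC

end BornSel

theorem corollaryC2 {X : Type*} [MetricSpace X] (𝔅 : Bornology X)
    (hproper : ¬ BornSel.Mem 𝔅 Set.univ) (hbase : BornSel.HasCompactBase 𝔅) :
    List.TFAE [
      ∀ n : ℕ, 1 ≤ n → BornSel.StrongHurewicz (BornSel.power 𝔅 n),
      BornSel.CountableFanTightness (BornSel.StrongC 𝔅) ∧
        BornSel.ReznichenkoProperty (BornSel.StrongC 𝔅),
      BornSel.SFin (BornSel.Omega (0 : BornSel.StrongC 𝔅)) (BornSel.OmegaGp (0 : BornSel.StrongC 𝔅)),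
      ¬ BornSel.OneHasWinningStrategyGFin (BornSel.Omega (0 : BornSel.StrongC 𝔅))
        (BornSel.OmegaGp (0 : BornSel.StrongC 𝔅))] := by
  tfae_have 1 → 4 := fun h =>
    ((BornSel.StrongHurewicz.of_power_one hbase (h 1 le_rfl)).hurewiczSelection hbase
      hproper).not_oneHasWinningStrategy
  tfae_have 4 → 3 := BornSel.sFin_of_not_oneHasWinningStrategy
  tfae_have 3 → 1 := fun h n _ => (BornSel.strongHurewicz_of_sFin hbase h).power hbase n
  tfae_have 3 → 2 := fun h =>
    BornSel.fanTightness_and_reznichenko_iff.2 (BornSel.StrongC.sFin_OmegaGp h)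
  tfae_have 2 → 3 := fun h => BornSel.fanTightness_and_reznichenko_iff.1 h 0
  tfae_finish
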